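/- Let $K$ be a field of characteristic $0$ and consider $K[x_1,\ldots,x_n]$ with the variables ordered $x_1<\cdots<x_n$ and with the corresponding lexicographical term order. For a nonconstant polynomial $F$, the leading variable $\mathrm{lv}(F)$ is the greatest variable appearing in $F$, and the initial $\mathrm{ini}(F)$ is the leading coefficient of $F$ viewed as a polynomial in $\mathrm{lv}(F)$. A triangular set is a finite nonempty ordered set $T=[T_1,\ldots,T_r]$ of nonconstant polynomials with $\mathrm{lv}(T_1)<\cdots<\mathrm{lv}(T_r)$. With $J=\mathrm{ini}(T_1)\cdots\mathrm{ini}(T_r)$, its saturated ideal is $\mathrm{sat}(T)=\{P : PJ^k\in\langle T\rangle \text{ for some } k\ge 0\}$ (and $\mathrm{sat}(\emptyset)=\langle 0\rangle$). The trivial triangular sets $[c]$ with $c\in K\setminus\{0\}$ are also admitted, with $\mathrm{sat}([c])=\langle 1\rangle$. A triangular set $T=[T_1,\ldots,T_r]$ is called regular if, for every $i=1,\ldots,r$, $\mathrm{ini}(T_i)$ is neither zero nor a zero divisor in $K[x_1,\ldots,x_n]/\mathrm{sat}([T_1,\ldots,T_{i-1}])$; by convention, the trivial sets $[c]$ are regular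 too. The W-characteristic set of an ideal $I$ with reduced lexicographical Gröbner basis $G$ consists of the constants in $G$ together with, for each $i=1,\ldots,n$ such that $G$ contains polynomials with leading variable $x_i$, the one among these with the smallest leading term; it is ordered by increasing leading variable. A reduced lexicographical Gröbner basis $G$ is called characterizable if $\langle G\rangle=\mathrm{sat}(C)$, where $C$ is the W-characteristic set of $\langle G\rangle$. Proposition. If $G\neq\emptyset$ is a characterizable Gröbner basis, then the W-characteristic set $C$ of $\langle G\rangle$ is regular. -/

import Mathlib

open MvPolynomial

noncomputable section

namespace WChar

/-- The lexicographic term order on exponents in the variables `x_0 < x_1 < ⋯ < x_{n-1}`.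
Mathlib's `MonomialOrder.lex` makes the variable with the smallest index the greatest one, so the
index type is reversed; see `lexOrder_lt_iff`. -/
def lexOrder (n : ℕ) : MonomialOrder (Fin n) where
  syn := (MonomialOrder.lex (σ := (Fin n)ᵒᵈ)).syn
  toSyn := (Finsupp.domCongr OrderDual.toDual).trans
    (MonomialOrder.lex (σ := (Fin n)ᵒᵈ)).toSyn
  toSyn_monotone := fun a b h =>
    (MonomialOrder.lex (σ := (Fin n)ᵒᵈ)).toSyn_monotone (fun i => h (OrderDual.ofDual i))

/-- `c < d` if and only if `c_j < d_j` at the largest index `j` where `c` and `d` differ. -/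
theorem lexOrder_lt_iff {n : ℕ} (c d : Fin n →₀ ℕ) :
    (lexOrder n).toSyn c < (lexOrder n).toSyn d ↔
      ∃ j, (∀ i, j < i → c i = d i) ∧ c j < d j := by
  change toLex (Finsupp.domCongr OrderDual.toDual c) <
    toLex (Finsupp.domCongr OrderDual.toDual d) ↔ _
  rw [Finsupp.Lex.lt_iff]
  exact Iff.rfl

variable {n : ℕ} {K : Type*} [Field K]

/-- The leading variable: the index of the greatest variable that appears in `F`; it is `⊥`
exactly for constant polynomials. -/
def lv (F : MvPolynomial (Fin n) K) : WithBot (Fin n) :=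
  F.vars.max

/-- The coefficient of `x_i ^ k` in `F`, for `k = deg(F, x_i)`, where `F` is seen as a polynomial in
`x_i` whose coefficients are polynomials in the other variables. -/
def leadCoeffIn (i : Fin n) (F : MvPolynomial (Fin n) K) : MvPolynomial (Fin n) K :=
  ∑ d ∈ F.support with d i = F.degreeOf i, monomial (d.erase i) (F.coeff d)

/-- The initial of `F`: its leading coefficient with respect to its leading variable.
(Initials of constants play no role; the value is set to `F` itself.) -/
def ini (F : MvPolynomial (Fin n) K) : MvPolynomial (Fin n) K :=
  WithBot.recBotCoe F (fun i => leadCoeffIn i F) (lv F)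

/-- A (nontrivial) triangular set: a finite nonempty ordered set of nonconstant polynomials with
strictly increasing leading variables. -/
def IsTriangularSet (T : List (MvPolynomial (Fin n) K)) : Prop :=
  T ≠ [] ∧ (∀ P ∈ T, lv P ≠ ⊥) ∧ T.Pairwise (fun P Q => lv P < lv Q)

/-- A trivial triangular set: `[c]` for a nonzero constant `c`. -/
def IsTrivialTriangularSet (T : List (MvPolynomial (Fin n) K)) : Prop :=
  ∃ c : K, c ≠ 0 ∧ T = [C c]

/-- The saturated ideal `{P | ∃ k, P * J ^ k ∈ ⟨T⟩}`, where `J` is the product of the initials of the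
polynomials in `T`. It is the unit ideal when `T = [c]` with `c` a nonzero constant (see
`sat_trivial`), and the zero ideal for the empty list. -/
def sat (T : List (MvPolynomial (Fin n) K)) : Ideal (MvPolynomial (Fin n) K) where
  carrier := {P | ∃ k : ℕ, P * (T.map ini).prod ^ k ∈ Ideal.span {Q | Q ∈ T}}
  zero_mem' := ⟨0, by simp⟩
  add_mem' := by
    rintro P Q ⟨k, hk⟩ ⟨l, hl⟩
    refine ⟨k + l, ?_⟩
    have h := Ideal.add_mem _ (Ideal.mul_mem_right ((T.map ini).prod ^ l) _ hk)
      (Ideal.mul_mem_right ((T.map ini).prod ^ k) _ hl)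
    convert h using 1
    ring
  smul_mem' := by
    rintro R P ⟨k, hk⟩
    refine ⟨k, ?_⟩
    rw [smul_eq_mul, mul_assoc]
    exact Ideal.mul_mem_left _ R hk

theorem sat_trivial {T : List (MvPolynomial (Fin n) K)} (hT : IsTrivialTriangularSet T) :
    sat T = ⊤ := by
  obtain ⟨c, hc, rfl⟩ := hT
  refine (Ideal.eq_top_iff_one _).2 ⟨0, ?_⟩
  have h : (C c⁻¹ : MvPolynomial (Fin n) K) * C c ∈ Ideal.span {Q | Q ∈ [(C c)]} :=
    Ideal.mul_mem_left _ _ (Ideal.subset_span (by simp))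
  rwa [← C_mul, inv_mul_cancel₀ hc, C_1, ← one_mul (1 : MvPolynomial (Fin n) K),
    ← pow_zero ((List.map ini [(C c : MvPolynomial (Fin n) K)]).prod)] at h

/-- Regular sets (regular chains): triangular sets `[T_1, …, T_r]` such that, for each `i`, the
initial of `T_i` is neither zero nor a zero divisor modulo `sat [T_1, …, T_{i-1}]`.
By convention the trivial triangular sets `[c]` are regular as well. -/
def IsRegularSet (T : List (MvPolynomial (Fin n) K)) : Prop :=
  IsTrivialTriangularSet T ∨
    (IsTriangularSet T ∧ ∀ (i : ℕ) (hi : i < T.length),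
      Ideal.Quotient.mk (sat (T.take i)) (ini T[i]) ≠ 0 ∧
        Ideal.Quotient.mk (sat (T.take i)) (ini T[i]) ∈
          nonZeroDivisors (MvPolynomial (Fin n) K ⧸ sat (T.take i)))

/-- `G` is a lexicographical Gröbner basis of the ideal `I`. -/
def IsGroebnerBasis (I : Ideal (MvPolynomial (Fin n) K)) (G : Finset (MvPolynomial (Fin n) K)) :
    Prop :=
  (∀ P ∈ G, P ∈ I) ∧
    Ideal.span ((lexOrder n).leadingTerm '' {P | P ∈ G}) =
      Ideal.span ((lexOrder n).leadingTerm '' {P | P ∈ I})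

/-- `G` is a reduced lexicographical Gröbner basis of `I`: its elements are monic, and no term of
any of them is divisible by the leading term of another one. -/
def IsReducedGroebnerBasis (I : Ideal (MvPolynomial (Fin n) K))
    (G : Finset (MvPolynomial (Fin n) K)) : Prop :=
  IsGroebnerBasis I G ∧ (∀ P ∈ G, (lexOrder n).Monic P) ∧
    ∀ P ∈ G, ∀ Q ∈ G, Q ≠ P → ∀ d ∈ P.support, ¬ (lexOrder n).degree Q ≤ d

open Classical in
/-- The reduced lexicographical Gröbner basis of `I` (every ideal has exactly one). -/
def reducedGroebnerBasis (I : Ideal (MvPolynomial (Fin n) K)) :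
    Finset (MvPolynomial (Fin n) K) :=
  if h : ∃ G, IsReducedGroebnerBasis I G then h.choose else ∅

/-- A polynomial in the nonempty finite set `S` with the smallest leading term. (The leading terms
of the elements of a reduced Gröbner basis are distinct, so it is unique in the use below.) -/
def smallest (S : Finset (MvPolynomial (Fin n) K)) (hS : S.Nonempty) : MvPolynomial (Fin n) K :=
  (S.exists_min_image (fun P => (lexOrder n).toSyn ((lexOrder n).degree P)) hS).choose

open Classical in
/-- The W-characteristic set of `I`: the constants in the reduced lexicographical Gröbner basis of
`I`, followed, for each variable in increasing order, by the smallest element of the basis with this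
leading variable, if there is any. -/
def wCharSet (I : Ideal (MvPolynomial (Fin n) K)) : List (MvPolynomial (Fin n) K) :=
  {P ∈ reducedGroebnerBasis I | lv P = ⊥}.toList ++
    (List.finRange n).filterMap (fun i =>
      if h : {P ∈ reducedGroebnerBasis I | lv P = i}.Nonempty then some (smallest _ h) else none)

/-- `G` is a characterizable Gröbner basis: it is the reduced lexicographical Gröbner basis of
the ideal `⟨G⟩`, and `⟨G⟩` is the saturated ideal of the W-characteristic set of `⟨G⟩`. -/
def IsCharacterizable (G : Finset (MvPolynomial (Fin n) K)) : Prop :=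
  IsReducedGroebnerBasis (Ideal.span {P | P ∈ G}) G ∧
    Ideal.span {P | P ∈ G} = sat (wCharSet (Ideal.span {P | P ∈ G}))

end WChar

end

/-!
If a nonzero element `P` of an ideal `I` is pseudo-divided by some `Q ∈ I` with leading variable
`x_v` and `deg(Q, x_v) ≤ deg(P, x_v)`, then the remainder lies again in `I`, and the vector of its
degrees is smaller. When the reduced Gröbner basis of `I = ⟨G⟩` contains no constants, its defining
property provides such a divisor `Q ∈ C` for every nonzero `P ∈ I`.

Now let `x_m` be the leading variable of `T_i ∈ C`, and let `P * ini(T_i) ∈ sat [T_1, …, T_{i-1}]`.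
Expanding `P` in the variables from `x_m` on, we may assume that `P` involves only the variables
below `x_m`. Since `sat [T_1, …, T_{i-1}] ⊆ sat C = I`, and the initials can be cancelled modulo
`sat C`, we get `P ∈ I`. Pseudo-dividing `P` repeatedly by elements of `C` now uses only
`T_1, …, T_{i-1}`, and reaches `0`, so that `P ∈ sat [T_1, …, T_{i-1}]`.
-/

namespace WChar

theorem mem_supported_iff_degreeOf_eq_zero {σ R : Type*} [CommSemiring R] {s : Set σ}
    {F : MvPolynomial σ R} : F ∈ supported R s ↔ ∀ j ∉ s, F.degreeOf j = 0 := by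
  simp only [mem_supported, Set.subset_def, Finset.mem_coe, mem_vars_iff_degreeOf_ne_zero]
  exact forall_congr' fun j => not_imp_comm

section SplitVars

variable {σ R : Type*} [CommRing R]

open Classical in
/-- A polynomial in all the variables, seen as a polynomial in the variables outside `s` with
coefficients in the polynomials in the variables in `s`. The variables in `s` are kept in the index
type of the result, but do not occur in it. -/
noncomputable def splitVars (s : Set σ) :
    MvPolynomial σ R →ₐ[R] MvPolynomial σ (supported R s) :=
  aeval fun j => if hj : j ∈ s then C ⟨X j, Algebra.subset_adjoin ⟨j, hj, rfl⟩⟩ else X j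

theorem splitVars_coe {s : Set σ} (a : supported R s) : splitVars s a.val = C a := by
  have h : (splitVars s).comp (supported R s).val =
      IsScalarTower.toAlgHom R (supported R s) (MvPolynomial σ (supported R s)) := by
    refine AlgHom.adjoin_ext ?_
    rintro _ ⟨j, hj, rfl⟩
    exact (aeval_X _ j).trans (dif_pos hj)
  exact DFunLike.congr_fun h a

theorem aeval_X_splitVars (s : Set σ) (F : MvPolynomial σ R) :
    aeval (R := supported R s) (X : σ → MvPolynomial σ R) (splitVars s F) = F := by
  have h : ((aeval (R := supported R s) (X : σ → MvPolynomial σ R)).restrictScalars R).comp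
      (splitVars s) = AlgHom.id R _ := by
    ext1 j
    by_cases hj : j ∈ s <;> simp [splitVars, hj]
  exact DFunLike.congr_fun h F

theorem mem_of_forall_coeff_splitVars_mem {s : Set σ} {I : Ideal (MvPolynomial σ R)}
    {F : MvPolynomial σ R} (h : ∀ d, ((splitVars s F).coeff d : supported R s).val ∈ I) :
    F ∈ I := by
  rw [← aeval_X_splitVars s F, aeval_def, eval₂_eq]
  exact sum_mem fun d _ => Ideal.mul_mem_right _ _ (h d)

theorem coeff_splitVars_mem_span {s : Set σ} {S : Set (MvPolynomial σ R)}
    (hS : S ⊆ supported R s) {F : MvPolynomial σ R} (hF : F ∈ Ideal.span S) (d : σ →₀ ℕ) :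
    ((splitVars s F).coeff d : supported R s).val ∈ Ideal.span S := by
  have hmap : splitVars s F ∈ (Ideal.span S).map (splitVars s) := Ideal.mem_map_of_mem _ hF
  suffices hle : (Ideal.span S).map (splitVars s) ≤
      ((Ideal.span S).comap (supported R s).val).map C from
    Ideal.mem_comap.1 (mem_map_C_iff.1 (hle hmap) d)
  rw [Ideal.map_span, Ideal.span_le]
  rintro _ ⟨Q, hQ, rfl⟩
  rw [SetLike.mem_coe, ← Subtype.coe_mk Q (hS hQ), splitVars_coe]
  exact Ideal.mem_map_of_mem C (Ideal.subset_span hQ)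

theorem coeff_splitVars_mul_mem_span {s : Set σ} {S : Set (MvPolynomial σ R)}
    (hS : S ⊆ supported R s) {F a : MvPolynomial σ R} (ha : a ∈ supported R s)
    (hF : F * a ∈ Ideal.span S) (d : σ →₀ ℕ) :
    ((splitVars s F).coeff d : supported R s).val * a ∈ Ideal.span S := by
  lift a to supported R s using ha
  have h := coeff_splitVars_mem_span hS hF d
  rwa [map_mul, splitVars_coe, mul_comm, coeff_C_mul, mul_comm, Subalgebra.coe_mul] at h

end SplitVars

section LeadingVariable

variable {n : ℕ} {K : Type*} [Field K] {F : MvPolynomial (Fin n) K} {v m : Fin n}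

theorem lv_lt_iff_mem_supported : lv F < m ↔ F ∈ supported K (Set.Iio m) := by
  simp [lv, Finset.max, Finset.sup_lt_iff, mem_supported, Set.subset_def]

theorem degreeOf_lv_pos (hv : lv F = v) : 0 < F.degreeOf v :=
  Nat.pos_of_ne_zero (mem_vars_iff_degreeOf_ne_zero.1 (Finset.mem_of_max hv))

theorem degreeOf_eq_zero_of_lv_lt (h : lv F < v) : F.degreeOf v = 0 :=
  mem_supported_iff_degreeOf_eq_zero.1 (lv_lt_iff_mem_supported.1 h) v (lt_irrefl v)

theorem lv_eq_bot_iff : lv F = ⊥ ↔ ∃ c, F = C c := by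
  rw [lv, Finset.max_eq_bot, vars_eq_empty_iff_eq_C]
  exact ⟨fun h => ⟨_, h⟩, by rintro ⟨c, rfl⟩; simp⟩

end LeadingVariable

section PseudoDivision

variable {n : ℕ} {K : Type*} [Field K]

theorem exists_of_mem_support_leadCoeffIn {F : MvPolynomial (Fin n) K} {i : Fin n}
    {d : Fin n →₀ ℕ} (hd : d ∈ (leadCoeffIn i F).support) : ∃ c ∈ F.support, d = c.erase i := by
  classical
  obtain ⟨c, hc, hdc⟩ := Finset.mem_biUnion.1 (support_sum hd)
  exact ⟨c, (Finset.mem_filter.1 hc).1, Finset.mem_singleton.1 (support_monomial_subset hdc)⟩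

theorem degreeOf_leadCoeffIn_self (i : Fin n) (F : MvPolynomial (Fin n) K) :
    (leadCoeffIn i F).degreeOf i = 0 := by
  rw [← Nat.le_zero, degreeOf_le_iff]
  intro d hd
  obtain ⟨c, -, rfl⟩ := exists_of_mem_support_leadCoeffIn hd
  rw [Finsupp.erase_same]

theorem degreeOf_leadCoeffIn_le (i j : Fin n) (F : MvPolynomial (Fin n) K) :
    (leadCoeffIn i F).degreeOf j ≤ F.degreeOf j := by
  rw [degreeOf_le_iff]
  intro d hd
  obtain ⟨c, hc, rfl⟩ := exists_of_mem_support_leadCoeffIn hd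
  calc c.erase i j ≤ c j := by rw [Finsupp.erase_apply]; split_ifs <;> simp
    _ ≤ F.degreeOf j := le_degreeOf_of_mem_support j hc

theorem exists_eq_X_pow_mul_leadCoeffIn_add (i : Fin n) (F : MvPolynomial (Fin n) K) :
    ∃ L, F = X i ^ F.degreeOf i * leadCoeffIn i F + L ∧
      (∀ j, L.degreeOf j ≤ F.degreeOf j) ∧ (0 < F.degreeOf i → L.degreeOf i < F.degreeOf i) := by
  classical
  set L := ∑ d ∈ F.support with ¬ d i = F.degreeOf i, monomial d (F.coeff d)
  have hL : ∀ d ∈ L.support, d ∈ F.support ∧ d i ≠ F.degreeOf i := by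
    intro d hd
    obtain ⟨c, hc, hdc⟩ := Finset.mem_biUnion.1 (support_sum hd)
    obtain rfl := Finset.mem_singleton.1 (support_monomial_subset hdc)
    exact Finset.mem_filter.1 hc
  have hlead : X i ^ F.degreeOf i * leadCoeffIn i F =
      ∑ d ∈ F.support with d i = F.degreeOf i, monomial d (F.coeff d) := by
    rw [leadCoeffIn, Finset.mul_sum]
    refine Finset.sum_congr rfl fun d hd => ?_
    rw [← (Finset.mem_filter.1 hd).2, X_pow_eq_monomial, monomial_mul, one_mul,
      Finsupp.single_add_erase]
  refine ⟨L, ?_, fun j => ?_, fun hpos => ?_⟩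
  · rw [hlead, Finset.sum_filter_add_sum_filter_not, support_sum_monomial_coeff]
  · exact degreeOf_le_iff.2 fun d hd => le_degreeOf_of_mem_support j (hL d hd).1
  · exact (degreeOf_lt_iff hpos).2 fun d hd =>
      (le_degreeOf_of_mem_support i (hL d hd).1).lt_of_ne (hL d hd).2

theorem exists_leadCoeffIn_mul_eq_mul_add {P Q : MvPolynomial (Fin n) K} {v : Fin n}
    (hpos : 0 < Q.degreeOf v) (hle : Q.degreeOf v ≤ P.degreeOf v) :
    ∃ A R, leadCoeffIn v Q * P = A * Q + R ∧ R.degreeOf v < P.degreeOf v ∧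
      ∀ j ≠ v, Q.degreeOf j = 0 → R.degreeOf j ≤ P.degreeOf j := by
  obtain ⟨LP, hP, hLP, hLPv⟩ := exists_eq_X_pow_mul_leadCoeffIn_add v P
  obtain ⟨LQ, hQ, hLQ, hLQv⟩ := exists_eq_X_pow_mul_leadCoeffIn_add v Q
  set A := X v ^ (P.degreeOf v - Q.degreeOf v) * leadCoeffIn v P
  have hX : (X v : MvPolynomial (Fin n) K) ^ P.degreeOf v =
      X v ^ (P.degreeOf v - Q.degreeOf v) * X v ^ Q.degreeOf v := by
    rw [← pow_add, Nat.sub_add_cancel hle]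
  have hdeg (j : Fin n) : (leadCoeffIn v Q * LP - A * LQ).degreeOf j ≤
      max ((leadCoeffIn v Q).degreeOf j + LP.degreeOf j) (A.degreeOf j + LQ.degreeOf j) :=
    (degreeOf_sub_le _ _ _).trans (max_le_max (degreeOf_mul_le ..) (degreeOf_mul_le ..))
  have hA (j : Fin n) : A.degreeOf j ≤
      (X v ^ (P.degreeOf v - Q.degreeOf v) : MvPolynomial (Fin n) K).degreeOf j +
        (leadCoeffIn v P).degreeOf j :=
    degreeOf_mul_le ..
  refine ⟨A, leadCoeffIn v Q * LP - A * LQ, ?_, (hdeg v).trans_lt (max_lt ?_ ?_),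
    fun j hj hQj => (hdeg j).trans (max_le ?_ ?_)⟩
  · linear_combination leadCoeffIn v Q * hP - A * hQ + leadCoeffIn v Q * leadCoeffIn v P * hX
  · rw [degreeOf_leadCoeffIn_self, zero_add]
    exact hLPv (hpos.trans_le hle)
  · have h := hA v
    rw [degreeOf_X_self_pow, degreeOf_leadCoeffIn_self] at h
    have := hLQv hpos
    omega
  · have := degreeOf_leadCoeffIn_le v j Q
    have := hLP j
    omega
  · have h := hA j
    rw [degreeOf_X_pow_of_ne _ hj] at h
    have := degreeOf_leadCoeffIn_le v j P
    have := hLQ j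
    omega

theorem ini_eq_leadCoeffIn {F : MvPolynomial (Fin n) K} {v : Fin n} (hv : lv F = v) :
    ini F = leadCoeffIn v F := by
  rw [ini, hv, WithBot.recBotCoe_coe]

theorem lv_ini_lt {F : MvPolynomial (Fin n) K} (hF : lv F ≠ ⊥) : lv (ini F) < lv F := by
  obtain ⟨v, hv⟩ := WithBot.ne_bot_iff_exists.1 hF
  rw [← hv, lv_lt_iff_mem_supported, mem_supported_iff_degreeOf_eq_zero, ini_eq_leadCoeffIn hv.symm]
  intro j hj
  rcases (Set.notMem_Iio.1 hj).eq_or_lt with rfl | hvj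
  · exact degreeOf_leadCoeffIn_self _ _
  · have hFj : F.degreeOf j = 0 :=
      degreeOf_eq_zero_of_lv_lt (hv ▸ WithBot.coe_lt_coe.2 hvj)
    exact Nat.le_zero.1 (hFj ▸ degreeOf_leadCoeffIn_le v j F)

/-- `P` is not reduced with respect to `Q` in the sense of Ritt: a step of pseudo-division of `P` by
`Q` in the leading variable of `Q` is possible. -/
def PseudoReducible (P Q : MvPolynomial (Fin n) K) : Prop :=
  ∃ v : Fin n, lv Q = v ∧ Q.degreeOf v ≤ P.degreeOf v

/-- The vector of the degrees of `F` in the single variables, ordered lexicographically with the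
greatest variable first. It decreases in each step of pseudo-division. -/
noncomputable def degreeVector (F : MvPolynomial (Fin n) K) : (lexOrder n).syn :=
  (lexOrder n).toSyn F.degrees.toFinsupp

theorem lexOrder_lt_of_apply_lt {c d : Fin n →₀ ℕ} {v : Fin n} (hlt : c v < d v)
    (hle : ∀ j, v < j → c j ≤ d j) : (lexOrder n).toSyn c < (lexOrder n).toSyn d := by
  by_contra! hdc
  obtain hdc | hdc := hdc.eq_or_lt
  · exact hlt.ne (DFunLike.congr_fun ((lexOrder n).toSyn.injective hdc) v).symm
  · obtain ⟨j, hj, hdcj⟩ := (lexOrder_lt_iff d c).1 hdc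
    rcases lt_trichotomy v j with hvj | rfl | hjv
    · exact (hle j hvj).not_gt hdcj
    · exact hlt.not_gt hdcj
    · exact hlt.ne (hj v hjv).symm

theorem not_pseudoReducible_one (Q : MvPolynomial (Fin n) K) : ¬ PseudoReducible 1 Q := by
  rintro ⟨v, hv, hle⟩
  rw [degreeOf_one] at hle
  exact (degreeOf_lv_pos hv).not_ge hle

theorem PseudoReducible.lv_le {P Q : MvPolynomial (Fin n) K} (h : PseudoReducible P Q) :
    lv Q ≤ lv P := by
  obtain ⟨v, hv, hle⟩ := h
  by_contra! hlt
  rw [hv] at hlt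
  exact ((degreeOf_lv_pos hv).trans_le hle).ne' (degreeOf_eq_zero_of_lv_lt hlt)

theorem PseudoReducible.exists_remainder {P Q : MvPolynomial (Fin n) K}
    (h : PseudoReducible P Q) :
    ∃ A R, ini Q * P = A * Q + R ∧ degreeVector R < degreeVector P ∧ lv R ≤ lv P := by
  have hQP := h.lv_le
  obtain ⟨v, hv, hle⟩ := h
  obtain ⟨A, R, hAR, hlt, hdeg⟩ := exists_leadCoeffIn_mul_eq_mul_add (degreeOf_lv_pos hv) hle
  have hRP (j : Fin n) (hj : v < j) : R.degreeOf j ≤ P.degreeOf j :=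
    hdeg j hj.ne' (degreeOf_eq_zero_of_lv_lt (hv ▸ WithBot.coe_lt_coe.2 hj))
  refine ⟨A, R, ini_eq_leadCoeffIn hv ▸ hAR, lexOrder_lt_of_apply_lt (v := v) ?_ fun j hj => ?_, ?_⟩
  · simpa [degreeOf_def] using hlt
  · simpa [degreeOf_def] using hRP j hj
  · by_contra! hPR
    obtain ⟨j, hj⟩ := WithBot.ne_bot_iff_exists.1 (bot_le.trans_lt hPR).ne'
    rw [← hj] at hPR
    have hvj : v < j := WithBot.coe_lt_coe.1 (hv ▸ hQP.trans_lt hPR)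
    exact ((degreeOf_lv_pos hj.symm).trans_le (hRP j hvj)).ne' (degreeOf_eq_zero_of_lv_lt hPR)

end PseudoDivision

section Saturation

variable {n : ℕ} {K : Type*} [Field K] {T U : List (MvPolynomial (Fin n) K)}
  {P Q : MvPolynomial (Fin n) K}

theorem mem_sat_of_mem (hQ : Q ∈ T) : Q ∈ sat T :=
  ⟨0, by rw [pow_zero, mul_one]; exact Ideal.subset_span hQ⟩

theorem mem_sat_of_ini_mul_mem (hQ : Q ∈ T) (h : ini Q * P ∈ sat T) : P ∈ sat T := by
  obtain ⟨k, hk⟩ := h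
  obtain ⟨A, hA⟩ := List.dvd_prod (List.mem_map_of_mem (f := ini) hQ)
  refine ⟨k + 1, ?_⟩
  convert Ideal.mul_mem_left _ A hk using 1
  linear_combination P * (T.map ini).prod ^ k * hA

theorem sat_mono (h : U.Sublist T) : sat U ≤ sat T := by
  rintro P ⟨k, hk⟩
  obtain ⟨A, hA⟩ := (h.map ini).prod_dvd_prod
  refine ⟨k, ?_⟩
  rw [hA, mul_pow, ← mul_assoc]
  exact Ideal.mul_mem_right _ _ (Ideal.span_mono (fun _ hQ => h.subset hQ) hk)

theorem mem_sat_of_forall_pseudoReducible {I : Ideal (MvPolynomial (Fin n) K)} {m : WithBot (Fin n)}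
    (hUI : ∀ Q ∈ U, Q ∈ I)
    (hred : ∀ P ∈ I, P ≠ 0 → lv P < m → ∃ Q ∈ U, PseudoReducible P Q)
    (hP : P ∈ I) (hPm : lv P < m) : P ∈ sat U := by
  induction hd : degreeVector P using WellFoundedLT.induction generalizing P with
  | ind d ih =>
    subst hd
    obtain rfl | hP0 := eq_or_ne P 0
    · exact zero_mem _
    obtain ⟨Q, hQ, hPQ⟩ := hred P hP hP0 hPm
    obtain ⟨A, R, hAR, hlt, hlv⟩ := hPQ.exists_remainder
    have hRI : R ∈ I := by
      rw [← add_sub_cancel_left (A * Q) R, ← hAR]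
      exact sub_mem (I.mul_mem_left _ hP) (I.mul_mem_left _ (hUI Q hQ))
    have hRU : R ∈ sat U := ih _ hlt hRI (hlv.trans_lt hPm) rfl
    refine mem_sat_of_ini_mul_mem hQ (hAR ▸ add_mem ?_ hRU)
    exact Ideal.mul_mem_left _ _ (mem_sat_of_mem hQ)

theorem mem_sat_of_mul_mem_sat {s : Set (Fin n)} {a : MvPolynomial (Fin n) K}
    (hU : ∀ Q ∈ U, Q ∈ supported K s) (hUini : ∀ Q ∈ U, ini Q ∈ supported K s)
    (ha : a ∈ supported K s)
    (hcancel : ∀ P ∈ supported K s, P * a ∈ sat U → P ∈ sat U) (hP : P * a ∈ sat U) :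
    P ∈ sat U := by
  obtain ⟨k, hk⟩ := hP
  have hJ : (U.map ini).prod ∈ supported K s := list_prod_mem <| by simpa using hUini
  rw [mul_assoc] at hk
  refine mem_of_forall_coeff_splitVars_mem (s := s) fun d => hcancel _ (Subtype.property _) ⟨k, ?_⟩
  rw [mul_assoc]
  exact coeff_splitVars_mul_mem_span hU (mul_mem ha (pow_mem hJ k)) hk d

theorem IsTriangularSet.mem_take_iff (hT : IsTriangularSet T) {i : ℕ} (hi : i < T.length) :
    Q ∈ T.take i ↔ Q ∈ T ∧ lv Q < lv T[i] := by
  have hmono := List.pairwise_iff_getElem.1 hT.2.2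
  rw [List.mem_take_iff_getElem]
  constructor
  · rintro ⟨j, hj, rfl⟩
    exact ⟨List.getElem_mem _, hmono j i _ hi (by omega)⟩
  · rintro ⟨hQ, hlt⟩
    obtain ⟨j, hj, rfl⟩ := List.getElem_of_mem hQ
    refine ⟨j, lt_min ?_ hj, rfl⟩
    by_contra! hij
    obtain rfl | hij := hij.eq_or_lt
    · exact hlt.false
    · exact hlt.not_gt (hmono i j hi hj hij)

theorem mem_sat_of_mul_ini_mem_sat_take {i : ℕ} (hi : i < T.length)
    (hP : P * ini T[i] ∈ sat (T.take i)) : P ∈ sat T :=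
  mem_sat_of_ini_mul_mem (List.getElem_mem hi)
    (mul_comm P _ ▸ sat_mono (List.take_sublist i T) hP)

theorem IsTriangularSet.mem_sat_take_of_mul_ini_mem (hT : IsTriangularSet T)
    (hred : ∀ P ∈ sat T, P ≠ 0 → ∃ Q ∈ T, PseudoReducible P Q) {i : ℕ} (hi : i < T.length)
    (hP : P * ini T[i] ∈ sat (T.take i)) : P ∈ sat (T.take i) := by
  obtain ⟨m, hm⟩ := WithBot.ne_bot_iff_exists.1 (hT.2.1 T[i] (List.getElem_mem hi))
  have hlt (Q) (hQ : Q ∈ T.take i) : lv Q < m := hm ▸ ((hT.mem_take_iff hi).1 hQ).2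
  have hini (Q) (hQ : Q ∈ T) : lv (ini Q) < lv Q := lv_ini_lt (hT.2.1 Q hQ)
  refine mem_sat_of_mul_mem_sat (s := Set.Iio m)
    (fun Q hQ => lv_lt_iff_mem_supported.1 (hlt Q hQ))
    (fun Q hQ => lv_lt_iff_mem_supported.1 ((hini Q (List.mem_of_mem_take hQ)).trans (hlt Q hQ)))
    (lv_lt_iff_mem_supported.1 (hm ▸ hini _ (List.getElem_mem hi))) (fun F hFm hF => ?_) hP
  refine mem_sat_of_forall_pseudoReducible (I := sat T) (m := m)
    (fun Q hQ => mem_sat_of_mem (List.mem_of_mem_take hQ)) (fun H hH hH0 hHm => ?_)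
    (mem_sat_of_mul_ini_mem_sat_take hi hF) (lv_lt_iff_mem_supported.2 hFm)
  obtain ⟨Q, hQ, hHQ⟩ := hred H hH hH0
  exact ⟨Q, (hT.mem_take_iff hi).2 ⟨hQ, hm ▸ hHQ.lv_le.trans_lt hHm⟩, hHQ⟩

theorem IsTriangularSet.isRegularSet (hT : IsTriangularSet T)
    (hred : ∀ P ∈ sat T, P ≠ 0 → ∃ Q ∈ T, PseudoReducible P Q) : IsRegularSet T := by
  refine Or.inr ⟨hT, fun i hi => ⟨fun hzero => ?_, mem_nonZeroDivisors_iff_right.2 fun x hx => ?_⟩⟩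
  · have hone : (1 : MvPolynomial (Fin n) K) ∈ sat T := by
      refine mem_sat_of_mul_ini_mem_sat_take hi ?_
      rwa [one_mul, ← Ideal.Quotient.eq_zero_iff_mem]
    obtain ⟨Q, -, hQ⟩ := hred 1 hone one_ne_zero
    exact not_pseudoReducible_one Q hQ
  · obtain ⟨P, rfl⟩ := Ideal.Quotient.mk_surjective x
    rw [← map_mul, Ideal.Quotient.eq_zero_iff_mem] at hx
    exact Ideal.Quotient.eq_zero_iff_mem.2 (hT.mem_sat_take_of_mul_ini_mem hred hi hx)

end Saturation

section GroebnerBasis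

variable {n : ℕ} {K : Type*} [Field K] {I : Ideal (MvPolynomial (Fin n) K)}
  {G : Finset (MvPolynomial (Fin n) K)} {P Q : MvPolynomial (Fin n) K}

theorem isReducedGroebnerBasis_reducedGroebnerBasis (h : ∃ G, IsReducedGroebnerBasis I G) :
    IsReducedGroebnerBasis I (reducedGroebnerBasis I) := by
  rw [reducedGroebnerBasis, dif_pos h]
  exact h.choose_spec

theorem IsReducedGroebnerBasis.ne_zero (hG : IsReducedGroebnerBasis I G) (hP : P ∈ G) : P ≠ 0 :=
  (hG.2.1 P hP).ne_zero

theorem IsReducedGroebnerBasis.exists_degree_le (hG : IsReducedGroebnerBasis I G) (hP : P ∈ I)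
    (hP0 : P ≠ 0) : ∃ Q ∈ G, (lexOrder n).degree Q ≤ (lexOrder n).degree P := by
  have hmem : (lexOrder n).leadingTerm P ∈
      Ideal.span ((lexOrder n).leadingTerm '' {P | P ∈ G}) := by
    rw [hG.1.2]
    exact Ideal.subset_span ⟨P, hP, rfl⟩
  have himage : (lexOrder n).leadingTerm '' {P | P ∈ G} =
      (fun d => monomial d (1 : K)) '' ((lexOrder n).degree '' {P | P ∈ G}) := by
    rw [Set.image_image]
    refine Set.image_congr fun Q hQ => ?_
    rw [MonomialOrder.leadingTerm, (hG.2.1 Q hQ).leadingCoeff_eq_one]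
  rw [himage, mem_ideal_span_monomial_image, MonomialOrder.support_leadingTerm' hP0] at hmem
  obtain ⟨_, ⟨Q, hQ, rfl⟩, hle⟩ := hmem _ (Finset.mem_singleton_self _)
  exact ⟨Q, hQ, hle⟩

theorem IsReducedGroebnerBasis.eq_of_lv_eq_bot (hG : IsReducedGroebnerBasis I G) (hP : P ∈ G)
    (hQ : Q ∈ G) (hbot : lv Q = ⊥) : P = Q := by
  by_contra hne
  obtain ⟨c, rfl⟩ := lv_eq_bot_iff.1 hbot
  refine hG.2.2 P hP _ hQ (Ne.symm hne) _ ((lexOrder n).degree_mem_support (hG.ne_zero hP)) ?_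
  rw [MonomialOrder.degree_C]
  exact zero_le

theorem degree_apply_le_degreeOf {σ R : Type*} [CommSemiring R] (o : MonomialOrder σ)
    (F : MvPolynomial σ R) (j : σ) : o.degree F j ≤ F.degreeOf j := by
  obtain rfl | hF := eq_or_ne F 0
  · rw [MonomialOrder.degree_zero]
    exact Nat.zero_le _
  · exact le_degreeOf_of_mem_support j (o.degree_mem_support hF)

theorem degreeOf_le_degree_apply {v : Fin n} (hQ : lv Q = v)
    (hle : (lexOrder n).toSyn ((lexOrder n).degree P) ≤
      (lexOrder n).toSyn ((lexOrder n).degree Q)) :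
    P.degreeOf v ≤ (lexOrder n).degree Q v := by
  refine degreeOf_le_iff.2 fun d hd => ?_
  by_contra! hlt
  refine (((lexOrder n).le_degree hd).trans hle).not_gt (lexOrder_lt_of_apply_lt hlt fun j hj => ?_)
  have hQj : Q.degreeOf j = 0 := degreeOf_eq_zero_of_lv_lt (hQ ▸ WithBot.coe_lt_coe.2 hj)
  exact (degree_apply_le_degreeOf _ Q j).trans (hQj ▸ Nat.zero_le _)

end GroebnerBasis

section WCharacteristicSet

variable {n : ℕ} {K : Type*} [Field K] {I : Ideal (MvPolynomial (Fin n) K)}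
  {P : MvPolynomial (Fin n) K}

theorem smallest_mem {S : Finset (MvPolynomial (Fin n) K)} (hS : S.Nonempty) : smallest S hS ∈ S :=
  (S.exists_min_image (fun P => (lexOrder n).toSyn ((lexOrder n).degree P)) hS).choose_spec.1

theorem degree_smallest_le {S : Finset (MvPolynomial (Fin n) K)} (hS : S.Nonempty) (hP : P ∈ S) :
    (lexOrder n).toSyn ((lexOrder n).degree (smallest S hS)) ≤
      (lexOrder n).toSyn ((lexOrder n).degree P) :=
  (S.exists_min_image (fun P => (lexOrder n).toSyn ((lexOrder n).degree P)) hS).choose_spec.2 P hP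

open Classical in
theorem wCharSet_eq_append (I : Ideal (MvPolynomial (Fin n) K)) :
    wCharSet I = {P ∈ reducedGroebnerBasis I | lv P = ⊥}.toList ++
      (List.finRange n).filterMap fun i : Fin n =>
        if h : {P ∈ reducedGroebnerBasis I | lv P = i}.Nonempty then some (smallest _ h)
        else none := by
  -- In the definition of `wCharSet`, the list that is filtered is elaborated as `List.finRange n`
  -- coerced to a list of elements of `WithBot (Fin n)`.
  have hcoe : ((List.finRange n).flatMap fun i : Fin n => [(i : WithBot (Fin n))]) =
      (List.finRange n).map WithBot.some := List.flatMap_pure_eq_map _ _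
  exact congrArg _ ((congrArg (List.filterMap _) hcoe).trans List.filterMap_map)

theorem mem_reducedGroebnerBasis_of_mem_wCharSet (hP : P ∈ wCharSet I) :
    P ∈ reducedGroebnerBasis I := by
  rw [wCharSet_eq_append, List.mem_append, Finset.mem_toList, Finset.mem_filter,
    List.mem_filterMap] at hP
  obtain ⟨hP, -⟩ | ⟨i, -, hi⟩ := hP
  · exact hP
  · split_ifs at hi with hne
    rw [← Option.some.inj hi]
    exact (Finset.mem_filter.1 (smallest_mem hne)).1

theorem exists_mem_wCharSet_degree_le (hP : P ∈ reducedGroebnerBasis I) {v : Fin n}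
    (hv : lv P = v) :
    ∃ Q ∈ wCharSet I, lv Q = v ∧
      (lexOrder n).toSyn ((lexOrder n).degree Q) ≤ (lexOrder n).toSyn ((lexOrder n).degree P) := by
  classical
  have hmem : P ∈ {P ∈ reducedGroebnerBasis I | lv P = v} := Finset.mem_filter.2 ⟨hP, hv⟩
  have hne : Finset.Nonempty _ := ⟨P, hmem⟩
  refine ⟨smallest _ hne, ?_, (Finset.mem_filter.1 (smallest_mem hne)).2,
    degree_smallest_le hne hmem⟩
  rw [wCharSet_eq_append]
  refine List.mem_append_right _ (List.mem_filterMap.2 ⟨v, List.mem_finRange v, ?_⟩)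
  convert dif_pos hne

theorem exists_mem_wCharSet_pseudoReducible
    (hG : IsReducedGroebnerBasis I (reducedGroebnerBasis I))
    (hnonconst : ∀ P ∈ reducedGroebnerBasis I, lv P ≠ ⊥) (hP : P ∈ I) (hP0 : P ≠ 0) :
    ∃ Q ∈ wCharSet I, PseudoReducible P Q := by
  obtain ⟨g, hg, hgP⟩ := hG.exists_degree_le hP hP0
  obtain ⟨v, hv⟩ := WithBot.ne_bot_iff_exists.1 (hnonconst g hg)
  obtain ⟨Q, hQ, hQv, hQg⟩ := exists_mem_wCharSet_degree_le hg hv.symm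
  refine ⟨Q, hQ, v, hQv, ?_⟩
  calc Q.degreeOf v ≤ (lexOrder n).degree g v := degreeOf_le_degree_apply hv.symm hQg
    _ ≤ (lexOrder n).degree P v := hgP v
    _ ≤ P.degreeOf v := degree_apply_le_degreeOf _ P v

theorem pairwise_lv_lt_wCharSet (hnonconst : ∀ P ∈ reducedGroebnerBasis I, lv P ≠ ⊥) :
    (wCharSet I).Pairwise (fun P Q => lv P < lv Q) := by
  rw [wCharSet_eq_append, Finset.filter_eq_empty_iff.2 fun P hP => hnonconst P hP,
    Finset.toList_empty, List.nil_append, List.pairwise_filterMap]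
  refine (List.pairwise_lt_finRange n).imp fun {i j} hij P hP Q hQ => ?_
  split_ifs at hP hQ with hi hj
  rw [← Option.some.inj hP, ← Option.some.inj hQ, (Finset.mem_filter.1 (smallest_mem hi)).2,
    (Finset.mem_filter.1 (smallest_mem hj)).2]
  exact WithBot.coe_lt_coe.2 hij

theorem isTriangularSet_wCharSet (hG : IsReducedGroebnerBasis I (reducedGroebnerBasis I))
    (hI : I ≠ ⊥) (hnonconst : ∀ P ∈ reducedGroebnerBasis I, lv P ≠ ⊥) :
    IsTriangularSet (wCharSet I) := by
  obtain ⟨P, hP, hP0⟩ := Submodule.exists_mem_ne_zero_of_ne_bot hI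
  obtain ⟨Q, hQ, -⟩ := exists_mem_wCharSet_pseudoReducible hG hnonconst hP hP0
  exact ⟨List.ne_nil_of_mem hQ,
    fun F hF => hnonconst F (mem_reducedGroebnerBasis_of_mem_wCharSet hF),
    pairwise_lv_lt_wCharSet hnonconst⟩

theorem isTrivialTriangularSet_wCharSet (hG : IsReducedGroebnerBasis I (reducedGroebnerBasis I))
    (hP : P ∈ reducedGroebnerBasis I) (hbot : lv P = ⊥) : IsTrivialTriangularSet (wCharSet I) := by
  have hsingleton : reducedGroebnerBasis I = {P} :=
    Finset.eq_singleton_iff_unique_mem.2 ⟨hP, fun Q hQ => hG.eq_of_lv_eq_bot hQ hP hbot⟩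
  obtain ⟨c, rfl⟩ := lv_eq_bot_iff.1 hbot
  refine ⟨c, fun hc => hG.ne_zero hP (by rw [hc, C_0]), ?_⟩
  simp [wCharSet_eq_append, hsingleton, Finset.filter_singleton, hbot]

end WCharacteristicSet

end WChar

theorem proposition3p2_general {K : Type*} [Field K] {n : ℕ}
    (G : Finset (MvPolynomial (Fin n) K)) (hne : G.Nonempty) (hG : WChar.IsCharacterizable G) :
    WChar.IsRegularSet (WChar.wCharSet (Ideal.span {P | P ∈ G})) := by
  obtain ⟨hG, hsat⟩ := hG
  obtain ⟨P, hP⟩ := hne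
  set I := Ideal.span {P | P ∈ G}
  have hI : I ≠ ⊥ := (Submodule.ne_bot_iff I).2 ⟨P, Ideal.subset_span hP, hG.ne_zero hP⟩
  have hred := WChar.isReducedGroebnerBasis_reducedGroebnerBasis ⟨G, hG⟩
  by_cases hnonconst : ∀ P ∈ WChar.reducedGroebnerBasis I, WChar.lv P ≠ ⊥
  · refine (WChar.isTriangularSet_wCharSet hred hI hnonconst).isRegularSet fun F hF hF0 => ?_
    exact WChar.exists_mem_wCharSet_pseudoReducible hred hnonconst (hsat ▸ hF) hF0
  · push Not at hnonconst
    obtain ⟨Q, hQ, hbot⟩ := hnonconst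
    exact Or.inl (WChar.isTrivialTriangularSet_wCharSet hred hQ hbot)

theorem proposition3p2 {K : Type*} [Field K] [CharZero K] {n : ℕ}
    (G : Finset (MvPolynomial (Fin n) K)) (hne : G.Nonempty) (hG : WChar.IsCharacterizable G) :
    WChar.IsRegularSet (WChar.wCharSet (Ideal.span {P | P ∈ G})) :=
  proposition3p2_general G hne hG
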